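/- Let $n,d,K\ge 1$ be integers, let $a_1,\dots,a_n\in\mathbb{R}^d$, and let $\{C_k\}_{k\in[K]}$ be a partition of $[n]$ into $K$ nonempty clusters. Write $\mu(S)=\frac1{|S|}\sum_{i\in S}a_i$, $\mu_k=\mu(C_k)$, and let $|C_{(K)}|=\min_k|C_k|$. Let $c\ge 100$ and suppose that $$\alpha\max_{k\in[K],\,i\in C_k}\|\mu_k-a_i\|<\min_{k\ne l}\|\mu_k-\mu_l\|\qquad\text{with}\qquad \alpha=2+\frac{2c\sqrt n}{\sqrt{|C_{(K)}|}}$$ (for $K=1$ the condition is void). Spectral $K$-means is the following algorithm, whose input is the data and the number $K$. Part I: let $A\in\mathbb{R}^{n\times d}$ be the matrix with rows $a_i$, let $\widehat a_i$ be the orthogonal projection of $a_i$ onto the span of the top $\min(K,d)$ right singular vectors of $A$, and find centers $\nu_1,\dots,\nu_K\in\mathbb{R}^d$ whose $K$-means cost $\frac12\sum_{i}\min_{j\in[K]}\|\widehat a_i-\nu_j\|^2$ is at most $1+10$ times the minimum of this cost over all choices of $K$ centers. Part II: put $S_k=\{i:\|\widehat a_i-\nu_k\|\le\frac13\|\widehat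 a_i-\nu_l\|\ \forall l\ne k\}$ and replace $\nu_k$ by $\mu(S_k)$, for all $k$. Part III: repeat, until the centers no longer change, the updates $S_k=\{i:\|a_i-\nu_k\|\le\|a_i-\nu_l\|\ \forall l\neq k\}$ and then $\nu_k=\mu(S_k)$, for all $k$; return the final clusters $S_1,\dots,S_K$. Then spectral $K$-means recovers the true clusters: Part I can be carried out, and for every choice of the singular vectors and every choice of approximate centers $\nu_1,\dots,\nu_K$ allowed in Part I, the algorithm terminates and the clusters it returns are $C_1,\dots,C_K$ up to renumbering. Moreover, let $C\in\mathbb{R}^{n\times d}$ be the matrix whose $i$-th row is $\mu_k$ for $i\in C_k$, let $\|\cdot\|$ be the operator norm and $\|\cdot\|_F$ the Frobenius norm, and let $\Delta_k=\frac1{\sqrt{|C_k|}}\min\{\sqrt K\|A-C\|,\|A-C\|_F\}$. Then the center separation condition $\|\mu_k-\mu_l\|\ge c(\Delta_k+\Delta_l)$ holds for all $k\ne l$, and so does the proximity condition: for all $k\neq l$ and $i\in C_k$, the orthogonal projection $P^i_{kl}$ of $a_i$ onto the line through $\mu_k$ and $\mu_l$ satisfies $$\|P^i_{kl}-\mu_l\|-\|P^i_{kl}-\mu_k\|\ge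 c\left(\frac1{\sqrt{|C_k|}}+\frac1{\sqrt{|C_l|}}\right)\|A-C\|.$$ -/

import Mathlib

open scoped RealInnerProductSpace

noncomputable section

namespace SpectralKMeans

/-- `C` is a clustering of the points `0, …, n - 1` into `K` clusters: the clusters are nonempty,
pairwise disjoint, and cover all the points. -/
structure IsClustering {n K : ℕ} (C : Fin K → Finset (Fin n)) : Prop where
  nonempty : ∀ k, (C k).Nonempty
  disjoint : ∀ k l, k ≠ l → Disjoint (C k) (C l)
  cover : ∀ i, ∃ k, i ∈ C k

/-- The mean `μ(S)` of the data points indexed by `S`; it is only meaningful for nonempty `S`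
(the value for the empty set is `0`). -/
def mean {n d : ℕ} (a : Fin n → EuclideanSpace ℝ (Fin d)) (S : Finset (Fin n)) :
    EuclideanSpace ℝ (Fin d) :=
  (S.card : ℝ)⁻¹ • ∑ i ∈ S, a i

/-- The size of the smallest cluster (the `K`-th largest of the `K` clusters). -/
def minCard {n K : ℕ} (C : Fin K → Finset (Fin n)) : ℕ :=
  ⨅ k, (C k).card

/-- `α · max_{k, i ∈ C k} ‖μ_k - a_i‖ < min_{p ≠ q} ‖μ_p - μ_q‖`, the maximum and the minimum over
finite families being written out as universal quantifiers. -/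
def IsSeparable {n d K : ℕ} (a : Fin n → EuclideanSpace ℝ (Fin d))
    (C : Fin K → Finset (Fin n)) (α : ℝ) : Prop :=
  ∀ k, ∀ i ∈ C k, ∀ p q, p ≠ q →
    α * ‖mean a (C k) - a i‖ < ‖mean a (C p) - mean a (C q)‖

/-- The data matrix, with `i`-th row `a i`. -/
def dataMatrix {n d : ℕ} (a : Fin n → EuclideanSpace ℝ (Fin d)) : Matrix (Fin n) (Fin d) ℝ :=
  Matrix.of fun i j => a i j

/-! ### The algorithm -/

/-- `v` is an orthonormal basis of right singular vectors of `A`, listed by decreasing singular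
value (that is, the right factor of a singular value decomposition of `A`). -/
def IsRightSingularBasis {n d : ℕ} (A : Matrix (Fin n) (Fin d) ℝ)
    (v : OrthonormalBasis (Fin d) ℝ (EuclideanSpace ℝ (Fin d))) : Prop :=
  ∃ σ : Fin d → ℝ, Antitone σ ∧ (∀ j, 0 ≤ σ j) ∧
    ∀ j, Matrix.toEuclideanLin (A.transpose * A) (v j) = (σ j ^ 2) • v j

/-- The data projected onto the span of the first `K` vectors of `v` (all of them if `d < K`). -/
def projectedData {n d : ℕ} (K : ℕ) (v : OrthonormalBasis (Fin d) ℝ (EuclideanSpace ℝ (Fin d)))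
    (a : Fin n → EuclideanSpace ℝ (Fin d)) : Fin n → EuclideanSpace ℝ (Fin d) :=
  fun i => (Submodule.span ℝ (v '' {j | (j : ℕ) < K})).starProjection (a i)

/-- The `K`-means cost `(1/2) ∑ i, min_j ‖a i - x j‖²` of the centers `x`. -/
def kMeansCost {n d K : ℕ} (a : Fin n → EuclideanSpace ℝ (Fin d))
    (x : Fin K → EuclideanSpace ℝ (Fin d)) : ℝ :=
  (1 / 2) * ∑ i, ⨅ j, ‖a i - x j‖ ^ 2

/-- `ν` is an `ε`-approximate solution of the `K`-means problem: its cost is at most `1 + ε` times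
the minimal one. -/
def IsApproxSolution {n d K : ℕ} (ε : ℝ) (a : Fin n → EuclideanSpace ℝ (Fin d))
    (ν : Fin K → EuclideanSpace ℝ (Fin d)) : Prop :=
  ∀ x : Fin K → EuclideanSpace ℝ (Fin d), kMeansCost a ν ≤ (1 + ε) * kMeansCost a x

/-- Part I: `v` and `ν` are admissible results of the singular value decomposition and of the
`10`-approximation algorithm run on the projected data. -/
def IsInitialization {n d K : ℕ} (a : Fin n → EuclideanSpace ℝ (Fin d))
    (v : OrthonormalBasis (Fin d) ℝ (EuclideanSpace ℝ (Fin d)))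
    (ν : Fin K → EuclideanSpace ℝ (Fin d)) : Prop :=
  IsRightSingularBasis (dataMatrix a) v ∧ IsApproxSolution 10 (projectedData K v a) ν

open Classical in
/-- Part II: the core points of each initial center, computed from the projected data `b`. -/
def corePoints {n d K : ℕ} (b : Fin n → EuclideanSpace ℝ (Fin d))
    (ν : Fin K → EuclideanSpace ℝ (Fin d)) (k : Fin K) : Finset (Fin n) :=
  Finset.univ.filter fun i => ∀ l, l ≠ k → ‖b i - ν k‖ ≤ (1 / 3) * ‖b i - ν l‖

/-- Part II: the refined centers, the means of the (original) data over the core points. -/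
def refinedCenters {n d K : ℕ} (a : Fin n → EuclideanSpace ℝ (Fin d))
    (v : OrthonormalBasis (Fin d) ℝ (EuclideanSpace ℝ (Fin d)))
    (ν : Fin K → EuclideanSpace ℝ (Fin d)) : Fin K → EuclideanSpace ℝ (Fin d) :=
  fun k => mean a (corePoints (projectedData K v a) ν k)

open Classical in
/-- The cluster update of Lloyd's algorithm. -/
def lloydClusters {n d K : ℕ} (a : Fin n → EuclideanSpace ℝ (Fin d))
    (ν : Fin K → EuclideanSpace ℝ (Fin d)) (k : Fin K) : Finset (Fin n) :=
  Finset.univ.filter fun i => ∀ l, l ≠ k → ‖a i - ν k‖ ≤ ‖a i - ν l‖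

/-- One iteration of Lloyd's algorithm (cluster update followed by center update), on centers. -/
def lloydStep {n d K : ℕ} (a : Fin n → EuclideanSpace ℝ (Fin d))
    (ν : Fin K → EuclideanSpace ℝ (Fin d)) : Fin K → EuclideanSpace ℝ (Fin d) :=
  fun k => mean a (lloydClusters a ν k)

/-- Part III: the centers after `t` iterations of Lloyd's algorithm from the refined centers. -/
def centersAt {n d K : ℕ} (a : Fin n → EuclideanSpace ℝ (Fin d))
    (v : OrthonormalBasis (Fin d) ℝ (EuclideanSpace ℝ (Fin d)))
    (ν : Fin K → EuclideanSpace ℝ (Fin d)) (t : ℕ) : Fin K → EuclideanSpace ℝ (Fin d) :=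
  (lloydStep a)^[t] (refinedCenters a v ν)

/-- Spectral `K`-means, with results `v`, `ν` of Part I, terminates and returns the clusters `S`:
Lloyd's algorithm is run up to the first time `T` at which the centers do not change any more, and
`S` is the clustering given by these centers. -/
def Returns {n d K : ℕ} (a : Fin n → EuclideanSpace ℝ (Fin d))
    (v : OrthonormalBasis (Fin d) ℝ (EuclideanSpace ℝ (Fin d)))
    (ν : Fin K → EuclideanSpace ℝ (Fin d)) (S : Fin K → Finset (Fin n)) : Prop :=
  ∃ T : ℕ, IsLeast {t | centersAt a v ν (t + 1) = centersAt a v ν t} T ∧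
    S = lloydClusters a (centersAt a v ν T)

/-- `S` and `C` are the same clustering, up to the numbering of the clusters. -/
def SameClustering {n K : ℕ} (S C : Fin K → Finset (Fin n)) : Prop :=
  ∃ π : Equiv.Perm (Fin K), ∀ k, S (π k) = C k

/-! ### The center separation and proximity conditions -/

open Classical in
/-- The matrix `A - C`, whose `i`-th row is `a i - μ_k` for the cluster `k` containing `i`. -/
def residualMatrix {n d K : ℕ} (a : Fin n → EuclideanSpace ℝ (Fin d))
    (C : Fin K → Finset (Fin n)) : Matrix (Fin n) (Fin d) ℝ :=
  dataMatrix fun i => a i - ∑ k, if i ∈ C k then mean a (C k) else 0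

/-- The operator norm induced by the Euclidean norms. -/
def opNorm {n d : ℕ} (M : Matrix (Fin n) (Fin d) ℝ) : ℝ :=
  ‖(Matrix.toEuclideanLin M).toContinuousLinearMap‖

/-- The Frobenius norm. -/
def frobNorm {n d : ℕ} (M : Matrix (Fin n) (Fin d) ℝ) : ℝ :=
  √(∑ i, ∑ j, M i j ^ 2)

/-- `Δ_k = |C_k|^{-1/2} min (√K ‖A - C‖) ‖A - C‖_F`. -/
def clusterWidth {n d K : ℕ} (a : Fin n → EuclideanSpace ℝ (Fin d))
    (C : Fin K → Finset (Fin n)) (k : Fin K) : ℝ :=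
  (1 / √((C k).card : ℝ)) *
    min (√(K : ℝ) * opNorm (residualMatrix a C)) (frobNorm (residualMatrix a C))

/-- The center separation condition with constant `c`. -/
def CenterSeparation {n d K : ℕ} (c : ℝ) (a : Fin n → EuclideanSpace ℝ (Fin d))
    (C : Fin K → Finset (Fin n)) : Prop :=
  ∀ k l, k ≠ l →
    c * (clusterWidth a C k + clusterWidth a C l) ≤ ‖mean a (C k) - mean a (C l)‖

/-- The orthogonal projection of `x` onto the line through `p` and `q`. -/
def projLine {d : ℕ} (p q x : EuclideanSpace ℝ (Fin d)) : EuclideanSpace ℝ (Fin d) :=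
  (EuclideanGeometry.orthogonalProjection (affineSpan ℝ {p, q}) x : EuclideanSpace ℝ (Fin d))

/-- The proximity condition with constant `c`. -/
def Proximity {n d K : ℕ} (c : ℝ) (a : Fin n → EuclideanSpace ℝ (Fin d))
    (C : Fin K → Finset (Fin n)) : Prop :=
  ∀ k, ∀ i ∈ C k, ∀ l, l ≠ k →
    c * (1 / √((C k).card : ℝ) + 1 / √((C l).card : ℝ)) * opNorm (residualMatrix a C) ≤
      ‖projLine (mean a (C k)) (mean a (C l)) (a i) - mean a (C l)‖ -
        ‖projLine (mean a (C k)) (mean a (C l)) (a i) - mean a (C k)‖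

end SpectralKMeans

end

namespace SpectralKMeans

/-! ### Low-rank approximation of the data -/

/-! Let `R` be the largest distance of a point to its cluster mean, `m` the smallest cluster size
and `r = √(n / m) * R`. Since `c ≥ 100` and `m ≤ n`, distinct means are more than `2R + 200r` apart
and `R ≤ r`. The residual has Frobenius norm at most `√n * R`, which gives both separation
conditions.

The true means span at most `K` dimensions, so optimality of the top singular subspace bounds the
total squared displacement of the data under projection by `nR²`. Averaging over a cluster yields a
point moved by at most `r`; contractivity of the projection carries this to the whole cluster.
Comparing the approximate centers with the projected means and averaging again puts an initial
center within `7r` of each mean (`exists_close_centers`). At this separation, the core points are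
exactly the true clusters, the refined centers are exactly the true means, and Lloyd's iteration
starts at a fixed point. -/

theorem inner_toEuclideanLin_gram {n d : ℕ} (a : Fin n → EuclideanSpace ℝ (Fin d))
    (x y : EuclideanSpace ℝ (Fin d)) :
    ⟪Matrix.toEuclideanLin ((dataMatrix a).transpose * dataMatrix a) x, y⟫ =
      ∑ i, ⟪a i, x⟫ * ⟪a i, y⟫ := by
  have key : ∀ z : EuclideanSpace ℝ (Fin d), ∀ i, (dataMatrix a).mulVec z.ofLp i = ⟪a i, z⟫ := by
    intro z i
    simp [dataMatrix, Matrix.mulVec, dotProduct, PiLp.inner_apply, mul_comm]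
  have h : ⟪Matrix.toEuclideanLin ((dataMatrix a).transpose * dataMatrix a) x, y⟫ =
      (dataMatrix a).mulVec x.ofLp ⬝ᵥ (dataMatrix a).mulVec y.ofLp := by
    rw [EuclideanSpace.inner_eq_star_dotProduct, Matrix.ofLp_toLpLin, Matrix.toLin'_apply,
      ← Matrix.mulVec_mulVec, star_trivial, Matrix.mulVec_transpose, dotProduct_comm,
      Matrix.dotProduct_mulVec]
  rw [h]
  simp [dotProduct, key]

theorem norm_sq_starProjection_eq_sum {E : Type*} [NormedAddCommGroup E] [InnerProductSpace ℝ E]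
    {ι : Type*} [Fintype ι] (U : Submodule ℝ E) [U.HasOrthogonalProjection]
    (b : OrthonormalBasis ι ℝ U) (x : E) :
    ‖U.starProjection x‖ ^ 2 = ∑ s, ⟪(b s : E), x⟫ ^ 2 := by
  have h := b.sum_sq_norm_inner_right (U.orthogonalProjectionOnto x)
  rw [Submodule.starProjection_apply]
  change ‖U.orthogonalProjectionOnto x‖ ^ 2 = _
  rw [← h]
  refine Finset.sum_congr rfl fun s _ => ?_
  rw [Real.norm_eq_abs, sq_abs,
    Submodule.inner_orthogonalProjectionOnto_eq_of_mem_left]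

/-- This is the trace of an orthogonal projection. It supplies the total weight in
`sum_mul_le_sum_initial`. -/
theorem sum_norm_sq_starProjection_basis {d : ℕ} {E : Type*} [NormedAddCommGroup E]
    [InnerProductSpace ℝ E] [FiniteDimensional ℝ E] (v : OrthonormalBasis (Fin d) ℝ E)
    (U : Submodule ℝ E) :
    ∑ j, ‖U.starProjection (v j)‖ ^ 2 = Module.finrank ℝ U := by
  simp_rw [norm_sq_starProjection_eq_sum U (stdOrthonormalBasis ℝ U)]
  rw [Finset.sum_comm]
  have : ∀ s, ∑ j, ⟪((stdOrthonormalBasis ℝ U s : U) : E), v j⟫ ^ 2 = 1 := by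
    intro s
    have h := v.sum_sq_norm_inner_left ((stdOrthonormalBasis ℝ U s : U) : E)
    simp only [Real.norm_eq_abs, sq_abs] at h
    rw [h, ← Submodule.coe_norm, (stdOrthonormalBasis ℝ U).norm_eq_one, one_pow]
  simp [this]

/-- The captured variance of a subspace, in terms of a basis of singular vectors. -/
theorem sum_norm_sq_starProjection_data {n d : ℕ} (a : Fin n → EuclideanSpace ℝ (Fin d))
    (v : OrthonormalBasis (Fin d) ℝ (EuclideanSpace ℝ (Fin d))) (σ : Fin d → ℝ)
    (hσ : ∀ j, Matrix.toEuclideanLin ((dataMatrix a).transpose * dataMatrix a) (v j) =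
      (σ j ^ 2) • v j) (U : Submodule ℝ (EuclideanSpace ℝ (Fin d))) :
    ∑ i, ‖U.starProjection (a i)‖ ^ 2 = ∑ j, σ j ^ 2 * ‖U.starProjection (v j)‖ ^ 2 := by
  simp_rw [norm_sq_starProjection_eq_sum U (stdOrthonormalBasis ℝ U), Finset.mul_sum]
  rw [Finset.sum_comm, Finset.sum_comm (s := (Finset.univ : Finset (Fin d)))]
  refine Finset.sum_congr rfl fun s _ => ?_
  set u := ((stdOrthonormalBasis ℝ U s : U) : EuclideanSpace ℝ (Fin d))
  -- The quadratic form of the Gram matrix at `u` is evaluated twice: over the data and over the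
  -- singular basis.
  have h1 := inner_toEuclideanLin_gram a u u
  have h2 : Matrix.toEuclideanLin ((dataMatrix a).transpose * dataMatrix a) u =
      ∑ j, (⟪v j, u⟫ * σ j ^ 2) • v j := by
    conv_lhs => rw [← v.sum_repr' u]
    simp only [map_sum, map_smul, hσ, smul_smul]
  rw [h2, sum_inner] at h1
  simp_rw [inner_smul_left] at h1
  calc ∑ i, ⟪u, a i⟫ ^ 2 = ∑ i, ⟪a i, u⟫ * ⟪a i, u⟫ :=
        Finset.sum_congr rfl fun i _ => by rw [real_inner_comm, sq]
    _ = _ := h1.symm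
    _ = _ := Finset.sum_congr rfl fun j _ => by
        rw [real_inner_comm u (v j)]; simp; ring

/-- Fractional knapsack: weights in `[0, 1]` of total at most `K` do best on the `K` largest values.
Subtracting the threshold `f K` makes the comparison termwise; the threshold times the total weight
is bounded separately, using `0 ≤ f K`. -/
theorem sum_mul_le_sum_initial {d K : ℕ} (f w : Fin d → ℝ) (hf : Antitone f) (hf0 : ∀ j, 0 ≤ f j)
    (hw0 : ∀ j, 0 ≤ w j) (hw1 : ∀ j, w j ≤ 1) (hw : ∑ j, w j ≤ K) :
    ∑ j, f j * w j ≤ ∑ j : Fin d, if (j : ℕ) < K then f j else 0 := by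
  by_cases hKd : K < d
  · set s := f ⟨K, hKd⟩ with hs
    have h1 : ∀ j, (f j - s) * w j ≤ if (j : ℕ) < K then f j - s else 0 := by
      intro j
      split_ifs with hj
      · have : s ≤ f j := hf (Fin.mk_le_mk.2 hj.le)
        nlinarith [hw1 j]
      · have : f j ≤ s := hf (Fin.mk_le_mk.2 (not_lt.1 hj))
        nlinarith [hw0 j]
    have h2 := Finset.sum_le_sum fun j (_ : j ∈ Finset.univ) => h1 j
    have h3 : ∑ j : Fin d, (if (j : ℕ) < K then s else 0) = K * s := by
      rw [← Finset.sum_filter, Finset.sum_const, nsmul_eq_mul]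
      congr 2
      rw [Fin.card_filter_val_lt, min_eq_right hKd.le]
    have h4 : ∀ j : Fin d, (if (j : ℕ) < K then f j - s else 0) =
        (if (j : ℕ) < K then f j else 0) - (if (j : ℕ) < K then s else 0) := by
      intro j; split_ifs <;> simp
    simp_rw [h4, sub_mul, Finset.sum_sub_distrib, h3, ← Finset.mul_sum] at h2
    have h5 := mul_le_mul_of_nonneg_left hw (hs ▸ hf0 ⟨K, hKd⟩ : 0 ≤ s)
    linarith
  · refine Finset.sum_le_sum fun j _ => ?_
    rw [if_pos (by omega)]
    nlinarith [hf0 j, hw1 j]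

/-- The span of the top `K` singular vectors is an optimal subspace of dimension at most `K`. -/
theorem sum_norm_sq_sub_projectedData_le {n d K : ℕ} (a : Fin n → EuclideanSpace ℝ (Fin d))
    (v : OrthonormalBasis (Fin d) ℝ (EuclideanSpace ℝ (Fin d)))
    (hv : IsRightSingularBasis (dataMatrix a) v)
    (U : Submodule ℝ (EuclideanSpace ℝ (Fin d))) (hU : Module.finrank ℝ U ≤ K)
    (y : Fin n → EuclideanSpace ℝ (Fin d)) (hy : ∀ i, y i ∈ U) :
    ∑ i, ‖a i - projectedData K v a i‖ ^ 2 ≤ ∑ i, ‖a i - y i‖ ^ 2 := by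
  obtain ⟨σ, hσa, hσ0, hσ⟩ := hv
  set P := Submodule.span ℝ (v '' {j | (j : ℕ) < K}) with hP
  have pyth : ∀ (W : Submodule ℝ (EuclideanSpace ℝ (Fin d))) (x : EuclideanSpace ℝ (Fin d)),
      ‖x - W.starProjection x‖ ^ 2 = ‖x‖ ^ 2 - ‖W.starProjection x‖ ^ 2 := by
    intro W x
    have h := Submodule.norm_sq_eq_add_norm_sq_starProjection x W
    rw [Submodule.starProjection_orthogonal_val] at h
    linarith
  have hPv : ∀ j, ‖P.starProjection (v j)‖ ^ 2 = if (j : ℕ) < K then 1 else 0 := by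
    intro j
    split_ifs with hj
    · rw [Submodule.starProjection_eq_self_iff.2
          (Submodule.subset_span (Set.mem_image_of_mem v hj)),
        v.norm_eq_one, one_pow]
    · have : v j ∈ Pᗮ := by
        rw [hP, Submodule.mem_orthogonal]
        intro u hu
        induction hu using Submodule.span_induction with
        | mem x hx =>
          obtain ⟨l, hl, rfl⟩ := hx
          exact v.orthonormal.2 (fun h : l = j => hj (h ▸ hl))
        | zero => simp
        | add x y _ _ hx hy => rw [inner_add_left, hx, hy, add_zero]
        | smul c x _ hx => rw [inner_smul_left, hx, mul_zero]
      simp [(Submodule.starProjection_apply_eq_zero_iff P).2 this]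
  -- By Pythagoras, minimal error means maximal captured variance. That variance weights `σ j ^ 2`
  -- by `‖U.starProjection (v j)‖ ^ 2`; for `P` the weights are the indicator of `j < K`.
  have hmain : ∑ i, ‖U.starProjection (a i)‖ ^ 2 ≤ ∑ i, ‖P.starProjection (a i)‖ ^ 2 := by
    rw [sum_norm_sq_starProjection_data a v σ hσ U, sum_norm_sq_starProjection_data a v σ hσ P]
    simp_rw [hPv, mul_ite, mul_one, mul_zero]
    refine sum_mul_le_sum_initial _ _ (fun i j hij => ?_) (fun j => sq_nonneg _)
      (fun j => sq_nonneg _) (fun j => ?_) ?_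
    · exact pow_le_pow_left₀ (hσ0 j) (hσa hij) 2
    · have h := Submodule.norm_starProjection_apply_le U (v j)
      rw [v.norm_eq_one] at h
      exact pow_le_one₀ (norm_nonneg _) h
    · rw [sum_norm_sq_starProjection_basis]
      exact_mod_cast hU
  calc ∑ i, ‖a i - projectedData K v a i‖ ^ 2
      = ∑ i, ‖a i‖ ^ 2 - ∑ i, ‖P.starProjection (a i)‖ ^ 2 := by
        rw [← Finset.sum_sub_distrib]
        exact Finset.sum_congr rfl fun i _ => pyth P (a i)
    _ ≤ ∑ i, ‖a i‖ ^ 2 - ∑ i, ‖U.starProjection (a i)‖ ^ 2 := by linarith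
    _ = ∑ i, ‖a i - U.starProjection (a i)‖ ^ 2 := by
        rw [← Finset.sum_sub_distrib]
        exact Finset.sum_congr rfl fun i _ => (pyth U (a i)).symm
    _ ≤ _ := by
        refine Finset.sum_le_sum fun i _ => pow_le_pow_left₀ (norm_nonneg _) ?_ 2
        rw [Submodule.starProjection_minimal]
        exact ciInf_le ⟨0, Set.forall_mem_range.2 fun _ => norm_nonneg _⟩ (⟨y i, hy i⟩ : U)

theorem exists_isRightSingularBasis {n d : ℕ} (a : Fin n → EuclideanSpace ℝ (Fin d)) :
    ∃ v, IsRightSingularBasis (dataMatrix a) v := by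
  set G := Matrix.toEuclideanLin ((dataMatrix a).transpose * dataMatrix a) with hG
  have hsymm : G.IsSymmetric := by
    intro x y
    rw [← real_inner_comm x, hG, inner_toEuclideanLin_gram, inner_toEuclideanLin_gram]
    exact Finset.sum_congr rfl fun i _ => mul_comm _ _
  have hd : Module.finrank ℝ (EuclideanSpace ℝ (Fin d)) = d := by simp
  have hnn : ∀ j, 0 ≤ hsymm.eigenvalues hd j := by
    intro j
    refine eigenvalue_nonneg_of_nonneg (hsymm.hasEigenvalue_eigenvalues hd j) fun x => ?_
    rw [← hsymm x x, hG, inner_toEuclideanLin_gram]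
    change 0 ≤ ∑ i, ⟪a i, x⟫ * ⟪a i, x⟫
    exact Finset.sum_nonneg fun i _ => mul_self_nonneg _
  refine ⟨hsymm.eigenvectorBasis hd, fun j => √(hsymm.eigenvalues hd j), fun i j hij =>
    Real.sqrt_le_sqrt (hsymm.eigenvalues_antitone hd hij), fun j => Real.sqrt_nonneg _, fun j => ?_⟩
  rw [Real.sq_sqrt (hnn j)]
  exact hsymm.apply_eigenvectorBasis hd j

/-! ### Optimal centers exist -/

theorem sum_norm_sq_sub_mean_le {n d : ℕ} (a : Fin n → EuclideanSpace ℝ (Fin d))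
    (S : Finset (Fin n)) (x : EuclideanSpace ℝ (Fin d)) :
    ∑ i ∈ S, ‖a i - mean a S‖ ^ 2 ≤ ∑ i ∈ S, ‖a i - x‖ ^ 2 := by
  rcases S.eq_empty_or_nonempty with rfl | hS
  · simp
  have hcard : (S.card : ℝ) ≠ 0 := by exact_mod_cast hS.card_ne_zero
  have h0 : ∑ i ∈ S, (a i - mean a S) = 0 := by
    rw [Finset.sum_sub_distrib, Finset.sum_const, ← Nat.cast_smul_eq_nsmul ℝ, mean, smul_smul,
      mul_inv_cancel₀ hcard, one_smul, sub_self]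
  have h1 : ∀ i, ‖a i - x‖ ^ 2 = ‖a i - mean a S‖ ^ 2 +
      2 * ⟪a i - mean a S, mean a S - x⟫ + ‖mean a S - x‖ ^ 2 := by
    intro i
    rw [← norm_add_sq_real, sub_add_sub_cancel]
  simp_rw [h1, Finset.sum_add_distrib, ← Finset.mul_sum, ← sum_inner, h0, inner_zero_left]
  have : 0 ≤ ∑ i ∈ S, ‖mean a S - x‖ ^ 2 := Finset.sum_nonneg fun _ _ => sq_nonneg _
  linarith

theorem kMeansCost_le_assignment {n d K : ℕ} (a : Fin n → EuclideanSpace ℝ (Fin d))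
    (x : Fin K → EuclideanSpace ℝ (Fin d)) (f : Fin n → Fin K) :
    kMeansCost a x ≤ (1 / 2) * ∑ i, ‖a i - x (f i)‖ ^ 2 := by
  refine mul_le_mul_of_nonneg_left (Finset.sum_le_sum fun i _ => ?_) (by norm_num)
  exact ciInf_le (Set.finite_range fun j => ‖a i - x j‖ ^ 2).bddBelow (f i)

theorem exists_assignment_kMeansCost_eq {n d K : ℕ} (hK : 1 ≤ K)
    (a : Fin n → EuclideanSpace ℝ (Fin d)) (x : Fin K → EuclideanSpace ℝ (Fin d)) :
    ∃ f : Fin n → Fin K, kMeansCost a x = (1 / 2) * ∑ i, ‖a i - x (f i)‖ ^ 2 := by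
  have : Nonempty (Fin K) := ⟨⟨0, hK⟩⟩
  choose f hf using fun i => exists_eq_ciInf_of_finite (f := fun j => ‖a i - x j‖ ^ 2)
  exact ⟨f, by simp [kMeansCost, hf]⟩

/-- For a fixed assignment the cluster means are optimal, so it suffices to minimize over the
finitely many assignments. The default mean of an empty fiber is harmless, as no point is assigned
to it. -/
theorem exists_kMeansCost_minimizer {n d K : ℕ} (hK : 1 ≤ K)
    (a : Fin n → EuclideanSpace ℝ (Fin d)) :
    ∃ ν : Fin K → EuclideanSpace ℝ (Fin d), ∀ x : Fin K → EuclideanSpace ℝ (Fin d),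
      kMeansCost a ν ≤ kMeansCost a x := by
  have : Nonempty (Fin K) := ⟨⟨0, hK⟩⟩
  let c : (Fin n → Fin K) → Fin K → EuclideanSpace ℝ (Fin d) := fun f k =>
    mean a (Finset.univ.filter fun i => f i = k)
  obtain ⟨f, hf⟩ := Finite.exists_min fun f : Fin n → Fin K => ∑ i, ‖a i - c f (f i)‖ ^ 2
  refine ⟨c f, fun x => ?_⟩
  obtain ⟨g, hg⟩ := exists_assignment_kMeansCost_eq hK a x
  refine (kMeansCost_le_assignment a (c f) f).trans ?_
  rw [hg]
  refine mul_le_mul_of_nonneg_left ((hf g).trans ?_) (by norm_num)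
  rw [← Finset.sum_fiberwise Finset.univ g, ← Finset.sum_fiberwise Finset.univ g]
  refine Finset.sum_le_sum fun k _ => ?_
  have hk : ∀ y : Fin K → EuclideanSpace ℝ (Fin d),
      ∑ i with g i = k, ‖a i - y (g i)‖ ^ 2 = ∑ i with g i = k, ‖a i - y k‖ ^ 2 := fun y =>
    Finset.sum_congr rfl fun i hi => by rw [(Finset.mem_filter.1 hi).2]
  rw [hk, hk]
  exact sum_norm_sq_sub_mean_le a _ (x k)

theorem exists_isInitialization {n d K : ℕ} (hK : 1 ≤ K) (a : Fin n → EuclideanSpace ℝ (Fin d)) :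
    ∃ v, ∃ ν : Fin K → EuclideanSpace ℝ (Fin d), IsInitialization a v ν := by
  obtain ⟨v, hv⟩ := exists_isRightSingularBasis a
  obtain ⟨ν, hν⟩ := exists_kMeansCost_minimizer hK (projectedData K v a)
  refine ⟨v, ν, hv, fun x => ?_⟩
  have h0 : 0 ≤ kMeansCost (projectedData K v a) x :=
    mul_nonneg (by norm_num) (Finset.sum_nonneg fun i _ => Real.iInf_nonneg fun j => sq_nonneg _)
  linarith [hν x]

/-! ### Norms -/

theorem opNorm_le_frobNorm {n d : ℕ} (M : Matrix (Fin n) (Fin d) ℝ) : opNorm M ≤ frobNorm M := by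
  refine ContinuousLinearMap.opNorm_le_bound _ (Real.sqrt_nonneg _) fun x => ?_
  have h0 : 0 ≤ ∑ i, ∑ j, M i j ^ 2 :=
    Finset.sum_nonneg fun i _ => Finset.sum_nonneg fun j _ => sq_nonneg _
  rw [EuclideanSpace.norm_eq, EuclideanSpace.norm_eq, frobNorm, ← Real.sqrt_mul h0,
    Finset.sum_mul]
  refine Real.sqrt_le_sqrt (Finset.sum_le_sum fun i _ => ?_)
  simp only [Real.norm_eq_abs, sq_abs]
  exact Finset.sum_mul_sq_le_sq_mul_sq Finset.univ (M i) x.ofLp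

theorem norm_projLine_sub_le {d : ℕ} (p q x : EuclideanSpace ℝ (Fin d)) :
    ‖projLine p q x - p‖ ≤ ‖x - p‖ := by
  have h := EuclideanGeometry.dist_sq_eq_dist_orthogonalProjection_sq_add_dist_orthogonalProjection_sq
    (𝕜 := ℝ) x (left_mem_affineSpan_pair ℝ p q)
  rw [dist_comm p x, dist_comm p, dist_eq_norm x p, dist_eq_norm _ p] at h
  refine abs_le_of_sq_le_sq' ?_ (norm_nonneg _) |>.2
  rw [sq, sq, h]
  exact le_add_of_nonneg_right (mul_self_nonneg _)

/-! ### Consequences of separability -/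

theorem IsClustering.eq_of_mem {n K : ℕ} {C : Fin K → Finset (Fin n)} (hC : IsClustering C)
    {i : Fin n} {k l : Fin K} (hk : i ∈ C k) (hl : i ∈ C l) : k = l := by
  by_contra h
  exact Finset.disjoint_left.1 (hC.disjoint k l h) hk hl

theorem minCard_le {n K : ℕ} (C : Fin K → Finset (Fin n)) (k : Fin K) :
    minCard C ≤ (C k).card :=
  ciInf_le (OrderBot.bddBelow _) k

theorem IsClustering.minCard_pos {n K : ℕ} (hK : 1 ≤ K) {C : Fin K → Finset (Fin n)}
    (hC : IsClustering C) : 0 < minCard C := by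
  have : Nonempty (Fin K) := ⟨⟨0, hK⟩⟩
  obtain ⟨k, hk⟩ := exists_eq_ciInf_of_finite (f := fun k => (C k).card)
  rw [minCard, ← hk]
  exact (hC.nonempty k).card_pos

theorem residualMatrix_eq {n d K : ℕ} (a : Fin n → EuclideanSpace ℝ (Fin d))
    {C : Fin K → Finset (Fin n)} (hC : IsClustering C) {κ : Fin n → Fin K}
    (hκ : ∀ i, i ∈ C (κ i)) :
    residualMatrix a C = dataMatrix fun i => a i - mean a (C (κ i)) := by
  unfold residualMatrix
  congr 1
  funext i
  rw [Finset.sum_eq_single (κ i) (fun k _ hk => if_neg fun h => hk (hC.eq_of_mem h (hκ i)))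
    (by simp), if_pos (hκ i)]

theorem frobNorm_dataMatrix {n d : ℕ} (a : Fin n → EuclideanSpace ℝ (Fin d)) :
    frobNorm (dataMatrix a) = √(∑ i, ‖a i‖ ^ 2) := by
  simp [frobNorm, dataMatrix, EuclideanSpace.norm_sq_eq]

theorem frobNorm_residualMatrix_le {n d K : ℕ} (a : Fin n → EuclideanSpace ℝ (Fin d))
    {C : Fin K → Finset (Fin n)} (hC : IsClustering C) {R : ℝ} (hR0 : 0 ≤ R)
    (hR : ∀ k, ∀ i ∈ C k, ‖a i - mean a (C k)‖ ≤ R) :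
    frobNorm (residualMatrix a C) ≤ √(n : ℝ) * R := by
  choose κ hκ using hC.cover
  rw [residualMatrix_eq a hC hκ, frobNorm_dataMatrix]
  refine Real.sqrt_le_iff.2 ⟨by positivity, ?_⟩
  rw [mul_pow, Real.sq_sqrt (Nat.cast_nonneg n)]
  calc ∑ i, ‖a i - mean a (C (κ i))‖ ^ 2 ≤ ∑ _i : Fin n, R ^ 2 :=
        Finset.sum_le_sum fun i _ => pow_le_pow_left₀ (norm_nonneg _) (hR _ i (hκ i)) 2
    _ = _ := by simp

/-- The largest distance of a point to the mean of its cluster. -/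
theorem exists_radius {n d K : ℕ} (hK : 1 ≤ K) (a : Fin n → EuclideanSpace ℝ (Fin d))
    {C : Fin K → Finset (Fin n)} (hC : IsClustering C) {α : ℝ} (hsep : IsSeparable a C α) :
    ∃ R, 0 ≤ R ∧ (∀ k, ∀ i ∈ C k, ‖a i - mean a (C k)‖ ≤ R) ∧
      ∀ p q, p ≠ q → α * R < ‖mean a (C p) - mean a (C q)‖ := by
  choose κ hκ using hC.cover
  obtain ⟨i₀, -⟩ := hC.nonempty ⟨0, hK⟩
  have : Nonempty (Fin n) := ⟨i₀⟩
  obtain ⟨i, hi⟩ := Finite.exists_max fun i => ‖a i - mean a (C (κ i))‖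
  refine ⟨‖a i - mean a (C (κ i))‖, norm_nonneg _, fun k j hj => ?_, fun p q hpq => ?_⟩
  · rw [hC.eq_of_mem hj (hκ j)]
    exact hi j
  · rw [norm_sub_rev]
    exact hsep _ i (hκ i) p q hpq

theorem inv_sqrt_card_le {n K : ℕ} (hK : 1 ≤ K) {C : Fin K → Finset (Fin n)}
    (hC : IsClustering C) (k : Fin K) : 1 / √((C k).card : ℝ) ≤ 1 / √(minCard C : ℝ) := by
  have h1 : (0 : ℝ) < minCard C := by exact_mod_cast hC.minCard_pos hK
  have h2 : (minCard C : ℝ) ≤ (C k).card := by exact_mod_cast minCard_le C k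
  exact one_div_le_one_div_of_le (Real.sqrt_pos.2 h1) (Real.sqrt_le_sqrt h2)

theorem centerSeparation_of_radius {n d K : ℕ} (hK : 1 ≤ K) (a : Fin n → EuclideanSpace ℝ (Fin d))
    {C : Fin K → Finset (Fin n)} (hC : IsClustering C) {c : ℝ} (hc : 0 ≤ c) {R : ℝ} (hR0 : 0 ≤ R)
    (hR : ∀ k, ∀ i ∈ C k, ‖a i - mean a (C k)‖ ≤ R)
    (hsep : ∀ p q, p ≠ q → (2 + 2 * c * √(n : ℝ) / √(minCard C : ℝ)) * R <
      ‖mean a (C p) - mean a (C q)‖) : CenterSeparation c a C := by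
  intro k l hkl
  have hw : ∀ k, clusterWidth a C k ≤ 1 / √(minCard C : ℝ) * (√(n : ℝ) * R) := fun k =>
    mul_le_mul (inv_sqrt_card_le hK hC k)
      ((min_le_right _ _).trans (frobNorm_residualMatrix_le a hC hR0 hR))
      (le_min (mul_nonneg (Real.sqrt_nonneg _) (norm_nonneg _)) (Real.sqrt_nonneg _))
      (by positivity)
  have h := mul_le_mul_of_nonneg_left (add_le_add (hw k) (hw l)) hc
  have h2 : (2 + 2 * c * √(n : ℝ) / √(minCard C : ℝ)) * R =
      2 * R + c * (1 / √(minCard C : ℝ) * (√(n : ℝ) * R) +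
        1 / √(minCard C : ℝ) * (√(n : ℝ) * R)) := by ring
  linarith [hsep k l hkl]

theorem proximity_of_radius {n d K : ℕ} (hK : 1 ≤ K) (a : Fin n → EuclideanSpace ℝ (Fin d))
    {C : Fin K → Finset (Fin n)} (hC : IsClustering C) {c : ℝ} (hc : 0 ≤ c) {R : ℝ} (hR0 : 0 ≤ R)
    (hR : ∀ k, ∀ i ∈ C k, ‖a i - mean a (C k)‖ ≤ R)
    (hsep : ∀ p q, p ≠ q → (2 + 2 * c * √(n : ℝ) / √(minCard C : ℝ)) * R <
      ‖mean a (C p) - mean a (C q)‖) : Proximity c a C := by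
  intro k i hi l hlk
  set P := projLine (mean a (C k)) (mean a (C l)) (a i)
  have h1 : ‖P - mean a (C k)‖ ≤ R := (norm_projLine_sub_le _ _ _).trans (hR k i hi)
  have h2 := norm_sub_le_norm_sub_add_norm_sub (mean a (C k)) P (mean a (C l))
  rw [norm_sub_rev _ P] at h2
  -- The left side of the condition is thus at most `2 * c * r`, with `r = √n / √(minCard C) * R`.
  -- The summand `2` in the separation constant pays for the `2R` lost when passing from the
  -- distance of the means to the difference of the distances from `P`.
  have h3 : opNorm (residualMatrix a C) ≤ √(n : ℝ) * R :=
    (opNorm_le_frobNorm _).trans (frobNorm_residualMatrix_le a hC hR0 hR)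
  have h4 : c * (1 / √((C k).card : ℝ) + 1 / √((C l).card : ℝ)) ≤
      c * (1 / √(minCard C : ℝ) + 1 / √(minCard C : ℝ)) :=
    mul_le_mul_of_nonneg_left
      (add_le_add (inv_sqrt_card_le hK hC k) (inv_sqrt_card_le hK hC l)) hc
  have h5 := mul_le_mul h4 h3 (norm_nonneg _) (by positivity)
  have h6 : (2 + 2 * c * √(n : ℝ) / √(minCard C : ℝ)) * R =
      2 * R + c * (1 / √(minCard C : ℝ) + 1 / √(minCard C : ℝ)) * (√(n : ℝ) * R) := by ring
  linarith [hsep k l hlk.symm]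

/-! ### The initial centers -/

/-- A function on the points with sum at most `B` is at most `B / |C k|` somewhere on `C k`. -/
theorem exists_mem_cluster_le {n K : ℕ} (hK : 1 ≤ K) {C : Fin K → Finset (Fin n)}
    (hC : IsClustering C) (g : Fin n → ℝ) (hg0 : ∀ i, 0 ≤ g i) {B : ℝ}
    (hg : ∑ i, g i ≤ B) (k : Fin K) : ∃ i ∈ C k, g i ≤ B / minCard C := by
  by_contra! h
  have hm : (0 : ℝ) < minCard C := by exact_mod_cast hC.minCard_pos hK
  have hB : 0 ≤ B := (Finset.sum_nonneg fun i _ => hg0 i).trans hg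
  have h1 : ∑ _i ∈ C k, B / (minCard C : ℝ) < ∑ i ∈ C k, g i :=
    Finset.sum_lt_sum_of_nonempty (hC.nonempty k) h
  have h2 : ∑ i ∈ C k, g i ≤ ∑ i, g i :=
    Finset.sum_le_sum_of_subset_of_nonneg (Finset.subset_univ _) fun i _ _ => hg0 i
  have h3 : (minCard C : ℝ) ≤ (C k).card := by exact_mod_cast minCard_le C k
  have h4 : (minCard C : ℝ) * (B / minCard C) = B := by field_simp
  have h5 := mul_le_mul_of_nonneg_right h3 (div_nonneg hB hm.le)
  rw [Finset.sum_const, nsmul_eq_mul] at h1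
  linarith

theorem sum_norm_sq_sub_add_le {ι E : Type*} [Fintype ι] [SeminormedAddCommGroup E]
    (x y z w : ι → E) :
    ∑ i, ‖x i - w i‖ ^ 2 ≤
      3 * (∑ i, ‖x i - y i‖ ^ 2 + ∑ i, ‖y i - z i‖ ^ 2 + ∑ i, ‖z i - w i‖ ^ 2) := by
  rw [← Finset.sum_add_distrib, ← Finset.sum_add_distrib, Finset.mul_sum]
  refine Finset.sum_le_sum fun i _ => ?_
  have h : ‖x i - w i‖ ≤ ‖x i - y i‖ + ‖y i - z i‖ + ‖z i - w i‖ := by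
    have h1 := norm_sub_le_norm_sub_add_norm_sub (x i) (y i) (w i)
    have h2 := norm_sub_le_norm_sub_add_norm_sub (y i) (z i) (w i)
    linarith
  have h' := pow_le_pow_left₀ (norm_nonneg _) h 2
  nlinarith [sq_nonneg (‖x i - y i‖ - ‖y i - z i‖), sq_nonneg (‖x i - y i‖ - ‖z i - w i‖),
    sq_nonneg (‖y i - z i‖ - ‖z i - w i‖)]

section Initialization

variable {n d K : ℕ} {a : Fin n → EuclideanSpace ℝ (Fin d)} {C : Fin K → Finset (Fin n)}
  {v : OrthonormalBasis (Fin d) ℝ (EuclideanSpace ℝ (Fin d))}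
  {ν : Fin K → EuclideanSpace ℝ (Fin d)}

theorem sum_norm_sq_sub_projectedData_le_residual (hv : IsRightSingularBasis (dataMatrix a) v)
    (κ : Fin n → Fin K) :
    ∑ i, ‖a i - projectedData K v a i‖ ^ 2 ≤ ∑ i, ‖a i - mean a (C (κ i))‖ ^ 2 := by
  refine sum_norm_sq_sub_projectedData_le a v hv
    (Submodule.span ℝ (Set.range fun k => mean a (C k))) ?_ _
    fun i => Submodule.subset_span (Set.mem_range_self _)
  simpa [Set.finrank] using finrank_range_le_card (R := ℝ) fun k => mean a (C k)

/-- The competitor is the family of projected true means. The projection is a contraction, so its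
cost is at most that of the true means on the original data; `11 = 1 + 10`. -/
theorem exists_assignment_of_isInitialization (hK : 1 ≤ K) (h : IsInitialization a v ν)
    (κ : Fin n → Fin K) :
    ∃ f : Fin n → Fin K, ∑ i, ‖ν (f i) - projectedData K v a i‖ ^ 2 ≤
      11 * ∑ i, ‖a i - mean a (C (κ i))‖ ^ 2 := by
  obtain ⟨f, hf⟩ := exists_assignment_kMeansCost_eq hK (projectedData K v a) ν
  set P := (Submodule.span ℝ (v '' {j | (j : ℕ) < K})).starProjection
  have h1 := h.2 fun k => P (mean a (C k))
  have h2 := kMeansCost_le_assignment (projectedData K v a) (fun k => P (mean a (C k))) κ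
  have h3 : ∑ i, ‖projectedData K v a i - P (mean a (C (κ i)))‖ ^ 2 ≤
      ∑ i, ‖a i - mean a (C (κ i))‖ ^ 2 := by
    refine Finset.sum_le_sum fun i _ => pow_le_pow_left₀ (norm_nonneg _) ?_ 2
    rw [projectedData, ← map_sub]
    exact Submodule.norm_starProjection_apply_le _ _
  refine ⟨f, ?_⟩
  simp_rw [norm_sub_rev (ν _)]
  linarith

/-- After Part I, the projected data lie close to the true means, and so do the initial centers,
up to their numbering. -/
theorem exists_close_centers (hK : 1 ≤ K) (hC : IsClustering C) {R : ℝ} (hR0 : 0 ≤ R)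
    (hR : ∀ k, ∀ i ∈ C k, ‖a i - mean a (C k)‖ ≤ R) (h : IsInitialization a v ν) :
    (∀ k, ∀ i ∈ C k, ‖projectedData K v a i - mean a (C k)‖ ≤
        3 * R + √(n : ℝ) / √(minCard C : ℝ) * R) ∧
      ∀ k, ∃ j, ‖ν j - mean a (C k)‖ ≤ 7 * (√(n : ℝ) / √(minCard C : ℝ) * R) := by
  choose κ hκ using hC.cover
  set E := ∑ i, ‖a i - mean a (C (κ i))‖ ^ 2
  set r := √(n : ℝ) / √(minCard C : ℝ) * R with hr
  have hr0 : 0 ≤ r := by positivity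
  have hEn : E ≤ n * R ^ 2 := by
    calc E ≤ ∑ _i : Fin n, R ^ 2 :=
          Finset.sum_le_sum fun i _ => pow_le_pow_left₀ (norm_nonneg _) (hR _ i (hκ i)) 2
      _ = _ := by simp
  have hr2 : n * R ^ 2 / minCard C = r ^ 2 := by
    rw [hr, mul_pow, div_pow, Real.sq_sqrt (Nat.cast_nonneg _), Real.sq_sqrt (Nat.cast_nonneg _)]
    ring
  have hproj : ∑ i, ‖a i - projectedData K v a i‖ ^ 2 ≤ E :=
    sum_norm_sq_sub_projectedData_le_residual h.1 κ
  constructor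
  · intro k i hi
    obtain ⟨j, hj, hj'⟩ := exists_mem_cluster_le hK hC _ (fun i => sq_nonneg _)
      (hproj.trans hEn) k
    rw [hr2] at hj'
    have h1 : ‖a j - projectedData K v a j‖ ≤ r := abs_le_of_sq_le_sq' hj' hr0 |>.2
    have h2 : ‖projectedData K v a i - projectedData K v a j‖ ≤ ‖a i - a j‖ := by
      rw [projectedData, projectedData, ← map_sub]
      exact Submodule.norm_starProjection_apply_le _ _
    have h3 := norm_sub_le_norm_sub_add_norm_sub (a i) (mean a (C k)) (a j)
    have h4 := norm_sub_le_norm_sub_add_norm_sub (projectedData K v a i)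
      (projectedData K v a j) (mean a (C k))
    have h5 := norm_sub_le_norm_sub_add_norm_sub (projectedData K v a j) (a j) (mean a (C k))
    rw [norm_sub_rev _ (a j)] at h5
    rw [norm_sub_rev (mean a (C k)) (a j)] at h3
    -- The route is `2R` from the projection of `a i` to that of `a j`, then `r` to `a j`, then `R`
    -- to the mean.
    linarith [hR k i hi, hR k j hj]
  · intro k
    obtain ⟨f, hf⟩ := exists_assignment_of_isInitialization (C := C) hK h κ
    have h1 := sum_norm_sq_sub_add_le (fun i => ν (f i)) (projectedData K v a) a
      (fun i => mean a (C (κ i)))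
    simp_rw [norm_sub_rev (projectedData K v a _)] at h1
    -- Here `39 = 3 * (11 + 1 + 1)`; the radius `7r` works because `39 ≤ 7 ^ 2`.
    have h2 : ∑ i, ‖ν (f i) - mean a (C (κ i))‖ ^ 2 ≤ 39 * (n * R ^ 2) := by linarith
    obtain ⟨i, hi, hi'⟩ := exists_mem_cluster_le hK hC _ (fun i => sq_nonneg _) h2 k
    rw [hC.eq_of_mem (hκ i) hi, mul_div_assoc, hr2] at hi'
    refine ⟨f i, abs_le_of_sq_le_sq' ?_ (by positivity) |>.2⟩
    nlinarith [sq_nonneg r]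

end Initialization

/-! ### Recovery of the clusters -/

theorem eq_cluster_of_forall {n K : ℕ} {C S : Fin K → Finset (Fin n)} (hC : IsClustering C)
    (π : Equiv.Perm (Fin K)) (h1 : ∀ k, ∀ i ∈ C k, i ∈ S (π k))
    (h2 : ∀ k, ∀ i ∈ C k, ∀ l, l ≠ k → i ∉ S (π l)) (k : Fin K) : S (π k) = C k := by
  ext i
  refine ⟨fun hi => ?_, h1 k i⟩
  obtain ⟨l, hl⟩ := hC.cover i
  by_contra hik
  exact h2 l i hl k (fun h => hik (h ▸ hl)) hi

theorem corePoints_eq {n d K : ℕ} {C : Fin K → Finset (Fin n)} (hC : IsClustering C)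
    (b : Fin n → EuclideanSpace ℝ (Fin d)) (ν : Fin K → EuclideanSpace ℝ (Fin d))
    (π : Equiv.Perm (Fin K))
    (h : ∀ k, ∀ i ∈ C k, ∀ l, l ≠ k → 3 * ‖b i - ν (π k)‖ < ‖b i - ν (π l)‖) (k : Fin K) :
    corePoints b ν (π k) = C k := by
  refine eq_cluster_of_forall hC π (fun k i hi => ?_) (fun k i hi l hl hmem => ?_) k
  · rw [corePoints, Finset.mem_filter]
    refine ⟨Finset.mem_univ _, fun l hl => ?_⟩
    have := h k i hi (π.symm l) fun h => hl (by simp [← h])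
    rw [Equiv.apply_symm_apply] at this
    linarith
  · rw [corePoints, Finset.mem_filter] at hmem
    have h1 := hmem.2 (π k) (π.injective.ne hl.symm)
    linarith [h k i hi l hl, norm_nonneg (b i - ν (π k))]

theorem lloydClusters_eq {n d K : ℕ} {C : Fin K → Finset (Fin n)} (hC : IsClustering C)
    (a : Fin n → EuclideanSpace ℝ (Fin d)) (ν : Fin K → EuclideanSpace ℝ (Fin d))
    (π : Equiv.Perm (Fin K))
    (h : ∀ k, ∀ i ∈ C k, ∀ l, l ≠ k → ‖a i - ν (π k)‖ < ‖a i - ν (π l)‖) (k : Fin K) :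
    lloydClusters a ν (π k) = C k := by
  refine eq_cluster_of_forall hC π (fun k i hi => ?_) (fun k i hi l hl hmem => ?_) k
  · rw [lloydClusters, Finset.mem_filter]
    refine ⟨Finset.mem_univ _, fun l hl => ?_⟩
    have := h k i hi (π.symm l) fun h => hl (by simp [← h])
    rw [Equiv.apply_symm_apply] at this
    exact this.le
  · rw [lloydClusters, Finset.mem_filter] at hmem
    exact (h k i hi l hl).not_ge (hmem.2 (π k) (π.injective.ne hl.symm))

theorem exists_returns_of_isInitialization {n d K : ℕ} (hK : 1 ≤ K)
    {a : Fin n → EuclideanSpace ℝ (Fin d)} {C : Fin K → Finset (Fin n)} (hC : IsClustering C)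
    {c : ℝ} (hc : 100 ≤ c) {R : ℝ} (hR0 : 0 ≤ R)
    (hR : ∀ k, ∀ i ∈ C k, ‖a i - mean a (C k)‖ ≤ R)
    (hsep : ∀ p q, p ≠ q → (2 + 2 * c * √(n : ℝ) / √(minCard C : ℝ)) * R <
      ‖mean a (C p) - mean a (C q)‖)
    {v : OrthonormalBasis (Fin d) ℝ (EuclideanSpace ℝ (Fin d))}
    {ν : Fin K → EuclideanSpace ℝ (Fin d)} (h : IsInitialization a v ν) :
    ∃ S, Returns a v ν S ∧ SameClustering S C := by
  obtain ⟨hb, hν⟩ := exists_close_centers hK hC hR0 hR h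
  set r := √(n : ℝ) / √(minCard C : ℝ) * R with hr
  have hr0 : 0 ≤ r := by positivity
  have hRr : R ≤ r := by
    have hm : (0 : ℝ) < minCard C := by exact_mod_cast hC.minCard_pos hK
    have hmn : (minCard C : ℝ) ≤ n := by
      exact_mod_cast (minCard_le C ⟨0, hK⟩).trans (card_finset_fin_le _)
    exact le_mul_of_one_le_left hR0
      ((one_le_div (Real.sqrt_pos.2 hm)).2 (Real.sqrt_le_sqrt hmn))
  have hδ : ∀ p q, p ≠ q → 2 * R + 200 * r < ‖mean a (C p) - mean a (C q)‖ := by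
    intro p q hpq
    refine lt_of_le_of_lt ?_ (hsep p q hpq)
    have h1 : (2 + 2 * c * √(n : ℝ) / √(minCard C : ℝ)) * R = 2 * R + 2 * c * r := by
      rw [hr]; ring
    nlinarith
  choose π' hπ' using hν
  -- A center shared by two means would put them within `14r` of each other.
  have hinj : Function.Injective π' := by
    intro p q hpq
    by_contra hne
    have h1 := norm_sub_le_norm_sub_add_norm_sub (mean a (C p)) (ν (π' p)) (mean a (C q))
    rw [norm_sub_rev _ (ν (π' p))] at h1
    have h2 := hπ' q
    rw [← hpq] at h2
    linarith [hπ' p, hδ p q hne]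
  let π : Equiv.Perm (Fin K) := Equiv.ofBijective π' (Finite.injective_iff_bijective.1 hinj)
  have hπ : ∀ k, ‖ν (π k) - mean a (C k)‖ ≤ 7 * r := hπ'
  have hcore : ∀ k, corePoints (projectedData K v a) ν (π k) = C k := by
    refine corePoints_eq hC _ ν π fun k i hi l hl => ?_
    have h1 := norm_sub_le_norm_sub_add_norm_sub (projectedData K v a i) (mean a (C k)) (ν (π k))
    have h2 := norm_sub_le_norm_sub_add_norm_sub (mean a (C k)) (projectedData K v a i)
      (mean a (C l))
    have h3 := norm_sub_le_norm_sub_add_norm_sub (projectedData K v a i) (ν (π l)) (mean a (C l))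
    rw [norm_sub_rev (mean a (C k)) (ν (π k))] at h1
    rw [norm_sub_rev _ (projectedData K v a i)] at h2
    -- The own center is within `3R + 8r` and every other one is farther than `192r - R`; tripling
    -- the former stays below since `R ≤ r`.
    linarith [hb k i hi, hπ k, hπ l, hδ k l hl.symm]
  have hcent : ∀ k, refinedCenters a v ν (π k) = mean a (C k) := fun k => by
    rw [refinedCenters, hcore k]
  have hlloyd : ∀ k, lloydClusters a (refinedCenters a v ν) (π k) = C k := by
    refine lloydClusters_eq hC _ _ π fun k i hi l hl => ?_
    rw [hcent, hcent]
    have h2 := norm_sub_le_norm_sub_add_norm_sub (mean a (C k)) (a i) (mean a (C l))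
    rw [norm_sub_rev _ (a i)] at h2
    linarith [hR k i hi, hδ k l hl.symm]
  have hfix : lloydStep a (refinedCenters a v ν) = refinedCenters a v ν := by
    funext k
    obtain ⟨k, rfl⟩ := π.surjective k
    rw [lloydStep, hlloyd, hcent]
  -- The stopping time is `0`: the refined centers are already fixed.
  exact ⟨_, ⟨0, ⟨hfix, fun t _ => Nat.zero_le t⟩, rfl⟩, π, hlloyd⟩

end SpectralKMeans

theorem lemma2 {n d K : ℕ} (hK : 1 ≤ K) (a : Fin n → EuclideanSpace ℝ (Fin d))
    (C : Fin K → Finset (Fin n)) (hC : SpectralKMeans.IsClustering C)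
    (c : ℝ) (hc : 100 ≤ c)
    (hsep : SpectralKMeans.IsSeparable a C
      (2 + 2 * c * √(n : ℝ) / √(SpectralKMeans.minCard C : ℝ))) :
    -- the clusterings returned by spectral `K`-means are the true one
    ((∃ v, ∃ ν : Fin K → EuclideanSpace ℝ (Fin d), SpectralKMeans.IsInitialization a v ν) ∧
      ∀ v, ∀ ν : Fin K → EuclideanSpace ℝ (Fin d), SpectralKMeans.IsInitialization a v ν →
        ∃ S, SpectralKMeans.Returns a v ν S ∧ SpectralKMeans.SameClustering S C) ∧
    -- the two conditions of Awasthi and Sheffet hold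
    SpectralKMeans.CenterSeparation c a C ∧ SpectralKMeans.Proximity c a C := by
  obtain ⟨R, hR0, hR, hδ⟩ := SpectralKMeans.exists_radius hK a hC hsep
  have hc0 : 0 ≤ c := by linarith
  exact ⟨⟨SpectralKMeans.exists_isInitialization hK a, fun v ν h =>
      SpectralKMeans.exists_returns_of_isInitialization hK hC hc hR0 hR hδ h⟩,
    SpectralKMeans.centerSeparation_of_radius hK a hC hc0 hR0 hR hδ,
    SpectralKMeans.proximity_of_radius hK a hC hc0 hR0 hR hδ⟩
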